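/- **Theorem (Steiner-type formula).** Let $n\ge 1$, let $B$ be the closed Euclidean unit ball of $\mathbb R^n$, and let $\mathcal H^n$ be Lebesgue measure on $\mathbb R^n$. For a non-empty compact convex set $K\subset\mathbb R^n$, the quermassintegrals $W_0(K),\dots,W_n(K)$ are the coefficients in the polynomial expansion $$\mathcal H^n(K+\rho B)=\sum_{i=0}^n\binom ni W_i(K)\,\rho^i\qquad(\rho\ge 0),$$ and $W_i(\emptyset)=0$. Let $f:\mathbb R^n\to[0,+\infty]$ be not identically zero, quasi-concave (that is, $f((1-\lambda)x_0+\lambda x_1)\ge\min\{f(x_0),f(x_1)\}$ for all $x_0,x_1\in\mathbb R^n$ and $\lambda\in[0,1]$), upper semicontinuous, and such that $f(x)\to 0$ as $\|x\|\to+\infty$. For $i=0,\dots,n$ put $$W_i(f)=\int_0^{+\infty}W_i(\{f\ge t\})\,dt\in[0,+\infty].$$ For $\rho>0$ put $f_\rho(x)=\sup\{f(y):\|y-x\|\le\rho\}$. Then, for every $\rho>0$, $$\int_{\mathbb R^n}f_\rho(x)\,dx=\sum_{i=0}^n\binom ni W_i(f)\,\rho^i,$$ as an equality in $[0,+\infty]$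 (both sides may be $+\infty$). -/

import Mathlib

open MeasureTheory
open scoped ENNReal Pointwise

namespace FunctionalSteiner

/-- `w 0, …, w n` are the coefficients of the polynomial expansion
`ℋⁿ(K + ρ B) = ∑ i, C(n,i) w i ρ ^ i` for all `ρ ≥ 0`, where `B` is the closed Euclidean unit ball.
For bounded `K` all the volumes are finite, so `volume.real` is the genuine Lebesgue measure. -/
def IsSteinerCoeff {n : ℕ} (K : Set (EuclideanSpace ℝ (Fin n))) (w : Fin (n + 1) → ℝ) : Prop :=
  ∀ ρ : ℝ, 0 ≤ ρ →
    volume.real (K + ρ • Metric.closedBall (0 : EuclideanSpace ℝ (Fin n)) 1) =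
      ∑ i : Fin (n + 1), (n.choose i : ℝ) * w i * ρ ^ (i : ℕ)

/-- The coefficients are uniquely determined by the set. -/
theorem IsSteinerCoeff.unique {n : ℕ} {K : Set (EuclideanSpace ℝ (Fin n))}
    {v w : Fin (n + 1) → ℝ} (hv : IsSteinerCoeff K v) (hw : IsSteinerCoeff K w) : v = w := by
  classical
  let P : (Fin (n + 1) → ℝ) → Polynomial ℝ := fun u =>
    ∑ i : Fin (n + 1), Polynomial.C ((n.choose i : ℝ) * u i) * Polynomial.X ^ (i : ℕ)
  have heval : ∀ u ρ, (P u).eval ρ = ∑ i : Fin (n + 1), (n.choose i : ℝ) * u i * ρ ^ (i : ℕ) := by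
    intro u ρ
    simp [P, Polynomial.eval_finsetSum]
  have hcoeff : ∀ u (j : Fin (n + 1)), (P u).coeff j = (n.choose j : ℝ) * u j := by
    intro u j
    simp only [P, Polynomial.finsetSum_coeff, Polynomial.coeff_C_mul, Polynomial.coeff_X_pow]
    rw [Finset.sum_eq_single j]
    · simp
    · intro b _ hb
      have : (j : ℕ) ≠ b := fun h => hb (Fin.ext h.symm)
      simp [this]
    · simp
  have hP : P v = P w := by
    refine Polynomial.eq_of_infinite_eval_eq _ _ ((Set.Ici_infinite (0 : ℝ)).mono ?_)
    intro ρ hρ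
    change (P v).eval ρ = (P w).eval ρ
    rw [heval, heval, ← hv ρ hρ, ← hw ρ hρ]
  funext j
  have h := congrArg (fun p => Polynomial.coeff p (j : ℕ)) hP
  simp only [hcoeff] at h
  have hpos : (n.choose j : ℝ) ≠ 0 :=
    Nat.cast_ne_zero.mpr (Nat.choose_pos (Nat.lt_succ_iff.mp j.2)).ne'
  exact mul_left_cancel₀ hpos h

open Classical in
/-- The `i`-th quermassintegral `W_i(K)`: the `i`-th coefficient in the polynomial expansion of
`ρ ↦ ℋⁿ(K + ρ B)`, with `W_i(∅) = 0`. The value `0` is assigned when there is no such expansion;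
that every convex body has one is not assumed anywhere. -/
noncomputable def quermass {n : ℕ} (i : Fin (n + 1)) (K : Set (EuclideanSpace ℝ (Fin n))) : ℝ :=
  if h : ∃ w : Fin (n + 1) → ℝ, IsSteinerCoeff K w then h.choose i else 0

theorem IsSteinerCoeff.quermass_eq {n : ℕ} {K : Set (EuclideanSpace ℝ (Fin n))}
    {w : Fin (n + 1) → ℝ} (hw : IsSteinerCoeff K w) (i : Fin (n + 1)) : quermass i K = w i := by
  have h : ∃ w : Fin (n + 1) → ℝ, IsSteinerCoeff K w := ⟨w, hw⟩
  rw [quermass, dif_pos h, h.choose_spec.unique hw]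

theorem quermass_empty {n : ℕ} (i : Fin (n + 1)) :
    quermass i (∅ : Set (EuclideanSpace ℝ (Fin n))) = 0 :=
  IsSteinerCoeff.quermass_eq (w := fun _ => 0) (fun ρ _ => by simp) i

/-- The class `𝒬ⁿ` of functions `f : ℝⁿ → [0, +∞]` that are not identically zero, quasi-concave,
upper semicontinuous and vanish at infinity. -/
structure QClass {n : ℕ} (f : EuclideanSpace ℝ (Fin n) → ℝ≥0∞) : Prop where
  ne_zero : f ≠ 0
  quasiconcave : QuasiconcaveOn ℝ Set.univ f
  upperSemicontinuous : UpperSemicontinuous f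
  vanishing : Filter.Tendsto f (Filter.cocompact (EuclideanSpace ℝ (Fin n))) (nhds 0)

/-- The functional quermassintegral `W_i(f) = ∫₀^∞ W_i({f ≥ t}) dt`, with values in `[0, +∞]`. -/
noncomputable def functionalQuermass {n : ℕ} (i : Fin (n + 1))
    (f : EuclideanSpace ℝ (Fin n) → ℝ≥0∞) : ℝ≥0∞ :=
  ∫⁻ t in Set.Ioi (0 : ℝ), ENNReal.ofReal (quermass i {x | ENNReal.ofReal t ≤ f x})

/-- `f_ρ(x) = sup_{y ∈ B_ρ(x)} f(y)`, with `B_ρ(x)` the closed ball. -/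
noncomputable def ballSup {n : ℕ} (ρ : ℝ) (f : EuclideanSpace ℝ (Fin n) → ℝ≥0∞)
    (x : EuclideanSpace ℝ (Fin n)) : ℝ≥0∞ :=
  ⨆ y ∈ Metric.closedBall x ρ, f y

end FunctionalSteiner

/-! For `t > 0` the superlevel set of `f_ρ` at height `t` is the parallel body `{f ≥ t} + ρB` of a
compact convex set (`setOf_le_ballSup`). The layer cake formula turns the integral of `f_ρ` into the
integral over `t` of the volumes of these bodies. Steiner's formula expands each volume, and the
expansion integrates term by term in `[0, ∞]` because the quermassintegrals are nonnegative and
measurable in `t`.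

Steiner's formula is itself proved, through zonotopes. Adding a segment to a convex body adds to its
volume the length of the segment times the measure of a projection (`prod_add_segment`), so the
volume of `K + ρZ` is a polynomial in `ρ` with nonnegative coefficients, by induction on the
dimension and on the number of segments. The ball is a limit of zonotopes, since the integral of
`|⟪x, u⟫|` over the ball is a multiple of `‖u‖` and can be discretised. Bounded nonnegative
coefficients then allow a passage to the limit by compactness. -/

namespace FunctionalSteiner

/-! ### Zonotopes -/

/-- The zonotope `∑ [-v, v]`, the sum running over the entries `v` of a list. -/
def zonotope {E : Type*} [AddCommGroup E] [Module ℝ E] : List E → Set E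
  | [] => {0}
  | v :: l => segment ℝ (-v) v + zonotope l

section Zonotope

variable {E F : Type*} [AddCommGroup E] [Module ℝ E] [AddCommGroup F] [Module ℝ F]

theorem convex_zonotope (l : List E) : Convex ℝ (zonotope l) := by
  induction l with
  | nil => exact convex_singleton 0
  | cons v l ih => exact (convex_segment _ _).add ih

theorem zonotope_nonempty (l : List E) : (zonotope l).Nonempty := by
  induction l with
  | nil => exact Set.singleton_nonempty 0
  | cons v l ih => exact Set.Nonempty.add ⟨_, left_mem_segment ℝ _ _⟩ ih

theorem image_zonotope (A : E →ₗ[ℝ] F) (l : List E) :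
    A '' zonotope l = zonotope (l.map A) := by
  induction l with
  | nil => simp [zonotope]
  | cons v l ih =>
    have h : A '' segment ℝ (-v) v = segment ℝ (-A v) (A v) := by
      have := image_segment ℝ A.toAffineMap (-v) v
      simpa using this
    rw [zonotope, Set.image_add, ih, h, List.map_cons, zonotope]

theorem smul_zonotope_cons (ρ : ℝ) (v : E) (l : List E) :
    ρ • zonotope (v :: l) = segment ℝ (-(ρ • v)) (ρ • v) + ρ • zonotope l := by
  have h : ρ • segment ℝ (-v) v = segment ℝ (-(ρ • v)) (ρ • v) := by
    have := image_segment ℝ (ρ • (LinearMap.id : E →ₗ[ℝ] E)).toAffineMap (-v) v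
    simpa [← Set.image_smul] using this
  rw [zonotope, smul_add, h]

end Zonotope

theorem isCompact_segment {E : Type*} [AddCommGroup E] [Module ℝ E] [TopologicalSpace E]
    [IsTopologicalAddGroup E] [ContinuousSMul ℝ E] (x y : E) : IsCompact (segment ℝ x y) := by
  rw [segment_eq_image]
  exact isCompact_Icc.image (by fun_prop)

theorem isCompact_zonotope {E : Type*} [AddCommGroup E] [Module ℝ E] [TopologicalSpace E]
    [IsTopologicalAddGroup E] [ContinuousSMul ℝ E] (l : List E) : IsCompact (zonotope l) := by
  induction l with
  | nil => exact isCompact_singleton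
  | cons v l ih => exact (isCompact_segment _ _).add ih

/-! ### Volume of a convex body plus a zonotope -/

theorem volume_add_Icc {s : Set ℝ} (hs : IsCompact s) (hc : Convex ℝ s) (hne : s.Nonempty)
    {t : ℝ} (ht : 0 ≤ t) :
    volume (s + Set.Icc (-t) t) = volume s + ENNReal.ofReal (2 * t) := by
  have hconn : IsConnected s := ⟨hne, hc.isPreconnected⟩
  have hsI := eq_Icc_of_connected_compact hconn hs
  have hab : sInf s ≤ sSup s := Real.sInf_le_sSup s hs.bddBelow hs.bddAbove
  generalize sInf s = a at *
  generalize sSup s = b at *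
  subst hsI
  rw [Set.Icc_add_Icc hab (by linarith), Real.volume_Icc, Real.volume_Icc,
    ← ENNReal.ofReal_add (by linarith) (by linarith)]
  congr 1
  ring

/-- Fubini along the direction of the segment: by convexity each line in that direction meets `S` in
an interval. A nonempty one grows by `2 * t`, an empty one stays empty, so the gain is `2 * t` over
the shadow of `S`. -/
theorem prod_add_segment {F : Type*} [NormedAddCommGroup F] [NormedSpace ℝ F]
    [MeasurableSpace F] [BorelSpace F] [SecondCountableTopology F] (ν : Measure F) [SFinite ν]
    {S : Set (ℝ × F)} (hS : IsCompact S) (hc : Convex ℝ S) {t : ℝ} (ht : 0 ≤ t) :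
    ((volume : Measure ℝ).prod ν) (S + segment ℝ (-((t, 0) : ℝ × F)) (t, 0)) =
      ((volume : Measure ℝ).prod ν) S + ENNReal.ofReal (2 * t) * ν (Prod.snd '' S) := by
  have hS' : IsCompact (S + segment ℝ (-((t, 0) : ℝ × F)) (t, 0)) :=
    hS.add (isCompact_segment _ _)
  have hseg : segment ℝ (-((t, 0) : ℝ × F)) (t, 0) =
      (fun x : ℝ => (x, (0 : F))) '' Set.Icc (-t) t := by
    have := image_segment ℝ (LinearMap.inl ℝ ℝ F).toAffineMap (-t) t
    rw [segment_eq_Icc (by linarith : -t ≤ t)] at this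
    simpa using this.symm
  have hslice : ∀ y : F, (fun x : ℝ => (x, y)) ⁻¹' (S + segment ℝ (-((t, 0) : ℝ × F)) (t, 0)) =
      (fun x : ℝ => (x, y)) ⁻¹' S + Set.Icc (-t) t := by
    intro y
    ext x
    rw [hseg]
    simp only [Set.mem_preimage, Set.mem_add, Set.mem_image]
    constructor
    · rintro ⟨⟨a, b⟩, hab, _, ⟨c, hc, rfl⟩, h⟩
      simp only [Prod.mk_add_mk, add_zero, Prod.mk.injEq] at h
      obtain ⟨h1, rfl⟩ := h
      exact ⟨a, hab, c, hc, h1⟩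
    · rintro ⟨a, ha, c, hc, rfl⟩
      exact ⟨(a, y), ha, (c, 0), ⟨c, hc, rfl⟩, by simp⟩
  rw [Measure.prod_apply_symm hS'.measurableSet, Measure.prod_apply_symm hS.measurableSet]
  have hm : MeasurableSet (Prod.snd '' S) := (hS.image continuous_snd).measurableSet
  rw [← lintegral_indicator_const hm, ← lintegral_add_right _ (measurable_const.indicator hm)]
  refine lintegral_congr fun y => ?_
  rw [hslice]
  by_cases hy : y ∈ Prod.snd '' S
  · rw [Set.indicator_of_mem hy]
    have hclosed : Topology.IsClosedEmbedding (fun x : ℝ => (x, y)) :=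
      Topology.IsClosedEmbedding.of_continuous_injective_isClosedMap (by fun_prop)
        (fun a b h => (Prod.mk.inj h).1) (isClosedMap_prodMk_right y)
    refine volume_add_Icc (hclosed.isCompact_preimage hS) ?_ ?_ ht
    · intro a ha b hb p q hp hq hpq
      have := hc ha hb hp hq hpq
      simpa [Prod.smul_mk, ← add_smul, hpq] using this
    · obtain ⟨⟨a, b⟩, hab, rfl⟩ := hy
      exact ⟨a, hab⟩
  · rw [Set.indicator_of_notMem hy]
    have : (fun x : ℝ => (x, y)) ⁻¹' S = ∅ := by
      ext x
      simp only [Set.mem_preimage, Set.mem_empty_iff_false, iff_false]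
      exact fun h => hy ⟨_, h, rfl⟩
    simp [this]

/-- Minkowski's theorem for zonotopes: `ρ ↦ μ (K + ρ Z)` is a polynomial with nonnegative
coefficients whose degree is at most the dimension. -/
theorem exists_polynomial_measure_add_zonotope (n : ℕ) :
    ∀ (E : Type) [NormedAddCommGroup E] [NormedSpace ℝ E] [FiniteDimensional ℝ E]
      [MeasurableSpace E] [BorelSpace E] (μ : Measure E) [μ.IsAddHaarMeasure],
      Module.finrank ℝ E = n → ∀ (l : List E) (K : Set E), IsCompact K → Convex ℝ K →
      ∃ p : Polynomial ℝ, p.natDegree ≤ n ∧ (∀ i, 0 ≤ p.coeff i) ∧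
        ∀ ρ : ℝ, 0 ≤ ρ → μ (K + ρ • zonotope l) = ENNReal.ofReal (p.eval ρ) := by
  induction n with
  | zero =>
    intro E _ _ _ _ _ μ _ hE l K hK hc
    have : Subsingleton E := Module.finrank_zero_iff.mp hE
    refine ⟨Polynomial.C (μ K).toReal, by simp, fun i => ?_, fun ρ hρ => ?_⟩
    · rw [Polynomial.coeff_C]
      split_ifs <;> simp
    · have : ρ • zonotope l = ({0} : Set E) :=
        (Set.Nonempty.smul_set (zonotope_nonempty l)).subset_singleton_iff.mp
          fun x _ => Subsingleton.elim _ _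
      rw [this, Set.add_singleton]
      simp [ENNReal.ofReal_toReal hK.measure_lt_top.ne]
  | succ n ih =>
    intro E _ _ _ _ _ μ _ hE l
    induction l with
    | nil =>
      intro K hK hc
      refine ⟨Polynomial.C (μ K).toReal, by simp, fun i => ?_, fun ρ hρ => ?_⟩
      · rw [Polynomial.coeff_C]
        split_ifs <;> simp
      · simp [zonotope, ENNReal.ofReal_toReal hK.measure_lt_top.ne]
    | cons v l ihl =>
      intro K hK hc
      obtain ⟨p, hpd, hpc, hp⟩ := ihl K hK hc
      by_cases hv : v = 0
      · refine ⟨p, hpd, hpc, fun ρ hρ => ?_⟩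
        rw [smul_zonotope_cons, hv]
        simpa using hp ρ hρ
      -- In coordinates sending `v` to `(1, 0)`, the new segment is handled by `prod_add_segment`.
      -- The shadow of `K + ρZ` in `F` is again a convex body plus `ρ` times a zonotope, one
      -- dimension lower.
      let F := Fin n → ℝ
      obtain ⟨A, hA⟩ : ∃ A : E ≃L[ℝ] ℝ × F, A v = (1, 0) := by
        let e : E ≃L[ℝ] ℝ × F := ContinuousLinearEquiv.ofFinrankEq (by simp [F, hE, add_comm])
        obtain ⟨B, hB⟩ := SeparatingDual.exists_continuousLinearEquiv_apply_eq (R := ℝ)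
          (x := e v) (y := ((1, 0) : ℝ × F)) (by simpa using hv) (by simp)
        exact ⟨e.trans B, by simpa using hB⟩
      have hhaar : (μ.map A).IsAddHaarMeasure := A.isAddHaarMeasure_map μ
      obtain ⟨c, hcμ⟩ : ∃ c : NNReal, μ.map A = c • (volume : Measure ℝ).prod (volume : Measure F) :=
        ⟨_, Measure.isAddLeftInvariant_eq_smul _ _⟩
      have hμ : ∀ S : Set E, μ S = c * ((volume : Measure ℝ).prod (volume : Measure F)) (A '' S) := by
        intro S
        have h1 : (μ.map A) (A '' S) = μ S := by
          have := A.toHomeomorph.toMeasurableEquiv.map_apply (μ := μ) (A '' S)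
          have h2 : A ⁻¹' (A '' S) = S := A.injective.preimage_image S
          rw [← h2]
          simpa [h2] using this
        rw [← h1, hcμ]
        rfl
      let π : E →L[ℝ] F := (ContinuousLinearMap.snd ℝ ℝ F).comp A.toContinuousLinearMap
      obtain ⟨q, hqd, hqc, hq⟩ := ih F volume (by simp [F]) (l.map π) (π '' K)
        (hK.image π.continuous) (hc.linear_image π.toLinearMap)
      -- The segment has length `2 * ρ` in the coordinates and `c` is the ratio of the Haar
      -- measures; the factor `ρ` accounts for the one extra degree.
      refine ⟨p + Polynomial.X * (Polynomial.C (2 * (c : ℝ)) * q), ?_, ?_, ?_⟩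
      · refine (Polynomial.natDegree_add_le _ _).trans (max_le hpd ?_)
        refine Polynomial.natDegree_mul_le.trans ?_
        have h1 := Polynomial.natDegree_C_mul_le (2 * (c : ℝ)) q
        have h2 := Polynomial.natDegree_X_le (R := ℝ)
        omega
      · intro i
        rw [Polynomial.coeff_add]
        refine add_nonneg (hpc i) ?_
        cases i with
        | zero => simp
        | succ i =>
          rw [Polynomial.coeff_X_mul, Polynomial.coeff_C_mul]
          exact mul_nonneg (by positivity) (hqc i)
      · intro ρ hρ
        have hcK : IsCompact (K + ρ • zonotope l) := hK.add ((isCompact_zonotope l).smul ρ)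
        have hvK : Convex ℝ (K + ρ • zonotope l) := hc.add ((convex_zonotope l).smul ρ)
        have hsplit : A '' (K + ρ • zonotope (v :: l)) = A '' (K + ρ • zonotope l) +
            segment ℝ (-((ρ, 0) : ℝ × F)) (ρ, 0) := by
          have hseg : A '' segment ℝ (-(ρ • v)) (ρ • v) = segment ℝ (-((ρ, 0) : ℝ × F)) (ρ, 0) := by
            have := image_segment ℝ A.toLinearMap.toAffineMap (-(ρ • v)) (ρ • v)
            simpa [hA] using this
          rw [smul_zonotope_cons, add_comm (segment ℝ _ _), ← add_assoc, Set.image_add, hseg]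
        have hproj : Prod.snd '' (A '' (K + ρ • zonotope l)) =
            π '' K + ρ • zonotope (l.map π) := by
          have h1 : Prod.snd '' (A '' (K + ρ • zonotope l)) = π '' (K + ρ • zonotope l) := by
            rw [Set.image_image]; rfl
          have h2 : π '' zonotope l = zonotope (l.map π) := image_zonotope π.toLinearMap l
          rw [h1, Set.image_add, image_smul_set, h2]
        rw [hμ, hsplit, prod_add_segment volume (hcK.image A.continuous)
          (hvK.linear_image A.toLinearMap) hρ, mul_add, ← hμ, hp ρ hρ, hproj, hq ρ hρ]
        have hpos : ∀ r : Polynomial ℝ, (∀ i, 0 ≤ r.coeff i) → 0 ≤ r.eval ρ := fun r hr => by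
          rw [Polynomial.eval_eq_sum_range]
          exact Finset.sum_nonneg fun i _ => mul_nonneg (hr i) (by positivity)
        have hq0 := hpos q hqc
        rw [← ENNReal.ofReal_mul (by positivity), ← ENNReal.ofReal_coe_nnreal,
          ← ENNReal.ofReal_mul (by positivity), ← ENNReal.ofReal_add (hpos p hpc) (by positivity)]
        congr 1
        simp
        ring

/-! ### Approximation of the ball by zonotopes -/

section Ball

variable {E : Type*} [NormedAddCommGroup E] [InnerProductSpace ℝ E]

/-- With `exists_mem_zonotope_inner_eq`, this identifies the support function of a zonotope, so that
inclusions reduce to inequalities between support functions. -/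
theorem inner_le_of_mem_zonotope (u : E) (l : List E) {z : E} (hz : z ∈ zonotope l) :
    inner ℝ z u ≤ (l.map fun v => |inner ℝ v u|).sum := by
  induction l generalizing z with
  | nil =>
    rw [zonotope, Set.mem_singleton_iff] at hz
    simp [hz]
  | cons v l ih =>
    obtain ⟨a, ⟨s, t, hs, ht, hst, rfl⟩, b, hb, rfl⟩ := hz
    have hb' := ih hb
    simp only [List.map_cons, List.sum_cons, inner_add_left, inner_smul_left, inner_neg_left,
      RCLike.conj_to_real]
    have h1 := le_abs_self (inner ℝ v u)
    have h2 := neg_abs_le (inner ℝ v u)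
    nlinarith

theorem exists_mem_zonotope_inner_eq (u : E) (l : List E) :
    ∃ z ∈ zonotope l, inner ℝ z u = (l.map fun v => |inner ℝ v u|).sum := by
  induction l with
  | nil => exact ⟨0, rfl, by simp⟩
  | cons v l ih =>
    obtain ⟨z, hz, hzu⟩ := ih
    rcases le_total 0 (inner ℝ v u) with h | h
    · refine ⟨v + z, Set.add_mem_add (right_mem_segment ℝ _ _) hz, ?_⟩
      rw [inner_add_left, hzu, List.map_cons, List.sum_cons, abs_of_nonneg h]
    · refine ⟨-v + z, Set.add_mem_add (left_mem_segment ℝ _ _) hz, ?_⟩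
      rw [inner_add_left, hzu, List.map_cons, List.sum_cons, abs_of_nonpos h, inner_neg_left]

theorem zonotope_subset_closedBall {l : List E} {r : ℝ}
    (h : ∀ u : E, (l.map fun v => |inner ℝ v u|).sum ≤ r * ‖u‖) (hr : 0 ≤ r) :
    zonotope l ⊆ Metric.closedBall 0 r := by
  intro z hz
  rw [mem_closedBall_zero_iff]
  have h1 := (inner_le_of_mem_zonotope z l hz).trans (h z)
  rw [real_inner_self_eq_norm_sq] at h1
  by_contra! hlt
  nlinarith [norm_nonneg z]

/-- A point of the ball outside the zonotope would be strictly separated from it by some `u`,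
contradicting the bound on the support function at `u`. -/
theorem closedBall_subset_zonotope [CompleteSpace E] {l : List E}
    (h : ∀ u : E, ‖u‖ ≤ (l.map fun v => |inner ℝ v u|).sum) :
    Metric.closedBall 0 1 ⊆ zonotope l := by
  intro x hx
  rw [mem_closedBall_zero_iff] at hx
  by_contra hxz
  obtain ⟨φ, s, hs, hsx⟩ := geometric_hahn_banach_closed_point (convex_zonotope l)
    (isCompact_zonotope l).isClosed hxz
  obtain ⟨u, rfl⟩ := (InnerProductSpace.toDual ℝ E).surjective φ
  simp only [InnerProductSpace.toDual_apply_apply] at hs hsx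
  obtain ⟨z, hz, hzu⟩ := exists_mem_zonotope_inner_eq u l
  have h1 := hs z hz
  have h2 := real_inner_le_norm u x
  have h3 := h u
  rw [real_inner_comm] at h1
  nlinarith [norm_nonneg u]

variable [FiniteDimensional ℝ E] [MeasurableSpace E] [BorelSpace E]

/-- The reflection exchanging `u` and `w` preserves the ball and its volume. -/
theorem setIntegral_abs_inner_eq_of_norm_eq {u w : E} (h : ‖u‖ = ‖w‖) :
    ∫ x in Metric.closedBall (0 : E) 1, |inner ℝ x u| =
      ∫ x in Metric.closedBall (0 : E) 1, |inner ℝ x w| := by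
  let R := (Submodule.span ℝ {u - w})ᗮ.reflection
  have hR : R u = w := Submodule.reflection_sub h
  have hpre : R ⁻¹' Metric.closedBall (0 : E) 1 = Metric.closedBall 0 1 := by
    simp
  have := (LinearIsometryEquiv.measurePreserving R).setIntegral_preimage_emb
    R.toHomeomorph.measurableEmbedding (fun x => |inner ℝ x w|) (Metric.closedBall 0 1)
  rw [hpre] at this
  rw [← this]
  refine integral_congr_ae (Filter.Eventually.of_forall fun x => ?_)
  simp only
  rw [← hR, R.inner_map_map]

theorem integrableOn_abs_inner (u : E) :
    IntegrableOn (fun x => |inner ℝ x u|) (Metric.closedBall (0 : E) 1) :=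
  (by fun_prop : Continuous fun x : E => |inner ℝ x u|).continuousOn.integrableOn_compact
    (isCompact_closedBall _ _)

/-- Up to the factor `c`, this writes the support function of the ball as a continuous superposition
of those of segments. -/
theorem exists_setIntegral_abs_inner_eq [Nontrivial E] :
    ∃ c : ℝ, 0 < c ∧ ∀ u : E, ∫ x in Metric.closedBall (0 : E) 1, |inner ℝ x u| = c * ‖u‖ := by
  obtain ⟨e, he⟩ := exists_norm_eq E (zero_le_one' ℝ)
  refine ⟨∫ x in Metric.closedBall (0 : E) 1, |inner ℝ x e|, ?_, fun u => ?_⟩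
  · rw [setIntegral_pos_iff_support_of_nonneg_ae
      (Filter.Eventually.of_forall fun x => abs_nonneg _) (integrableOn_abs_inner e)]
    have hopen : IsOpen ((Function.support fun x : E => |inner ℝ x e|) ∩ Metric.ball 0 1) := by
      refine IsOpen.inter ?_ Metric.isOpen_ball
      exact (by fun_prop : Continuous fun x : E => |inner ℝ x e|).isOpen_support
    refine (hopen.measure_pos volume ⟨(1 / 2 : ℝ) • e, ?_, ?_⟩).trans_le
      (measure_mono (Set.inter_subset_inter_right _ Metric.ball_subset_closedBall))
    · simp [inner_smul_left, he]
    · simp only [mem_ball_zero_iff, norm_smul, he]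
      norm_num
  · have h1 : ‖u‖ = ‖‖u‖ • e‖ := by simp [norm_smul, he]
    rw [setIntegral_abs_inner_eq_of_norm_eq h1, mul_comm, ← integral_const_mul]
    simp [inner_smul_right, abs_mul]

/-- The Euclidean ball is a limit of zonotopes. -/
theorem exists_zonotope_between_closedBall [Nontrivial E] {ε : ℝ} (hε : 0 < ε) :
    ∃ l : List E, Metric.closedBall 0 1 ⊆ zonotope l ∧
      zonotope l ⊆ Metric.closedBall 0 (1 + ε) := by
  obtain ⟨c, hc, hcu⟩ := exists_setIntegral_abs_inner_eq (E := E)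
  set μ := (volume : Measure E).restrict (Metric.closedBall 0 1) with hμ
  have : IsFiniteMeasure μ := ⟨by
    simpa [hμ] using (isCompact_closedBall (0 : E) 1).measure_lt_top⟩
  -- Solves `(c + δ) / (c - δ) = 1 + ε`, the ratio of the two bounds obtained for the support
  -- function.
  set δ : ℝ := c * ε / (2 + ε) with hδ
  have hδ0 : 0 < δ := by positivity
  have hcδ : 0 < c - δ := by
    have : δ < c := by
      rw [hδ, div_lt_iff₀ (by positivity)]
      nlinarith
    linarith
  have hid : MemLp (fun x : E => x) 1 μ := by
    rw [memLp_one_iff_integrable]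
    exact continuous_id.continuousOn.integrableOn_compact (isCompact_closedBall _ _)
  obtain ⟨s, hs, hsm⟩ := hid.exists_simpleFunc_eLpNorm_sub_lt ENNReal.one_ne_top
    (ENNReal.ofReal_pos.mpr hδ0).ne'
  rw [memLp_one_iff_integrable] at hid hsm
  have hs' : ∫ x, ‖x - s x‖ ∂μ ≤ δ := by
    rw [eLpNorm_one_eq_lintegral_enorm] at hs
    refine (integral_norm_eq_lintegral_enorm (hid.sub hsm).aestronglyMeasurable).trans_le ?_
    exact ENNReal.toReal_le_of_le_ofReal hδ0.le hs.le
  have hint : ∀ u : E, Integrable (fun x => |inner ℝ (s x) u|) μ := fun u =>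
    (hsm.inner_const u).abs
  have hsum : ∀ u : E, ∫ x, |inner ℝ (s x) u| ∂μ =
      ∑ y ∈ s.range, μ.real (s ⁻¹' {y}) * |inner ℝ y u| := fun u => by
    have h := SimpleFunc.map_integral s (fun y => |inner ℝ y u|) hsm (by simp)
    rw [SimpleFunc.integral_eq_integral _ (by
      simpa [Function.comp_def] using hint u)] at h
    simpa using h
  have hclose : ∀ u : E, |∫ x, |inner ℝ (s x) u| ∂μ - c * ‖u‖| ≤ δ * ‖u‖ := fun u => by
    rw [← hcu u, ← integral_sub (hint u) (integrableOn_abs_inner u)]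
    refine abs_integral_le_integral_abs.trans ?_
    refine (integral_mono ((hint u).sub (integrableOn_abs_inner u)).abs
      ((hid.sub hsm).norm.mul_const ‖u‖) fun x => ?_).trans ?_
    · refine (abs_abs_sub_abs_le _ _).trans ?_
      rw [← inner_sub_left, Pi.sub_apply, norm_sub_rev]
      exact abs_real_inner_le_norm _ _
    · rw [integral_mul_const]
      exact mul_le_mul_of_nonneg_right hs' (norm_nonneg u)
  -- The integral of `|⟪s x, u⟫|` is a finite sum over the values of `s`, hence the support function
  -- of a zonotope. Dividing by `c - δ` brings it to at least `‖u‖`.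
  let l : List E := s.range.toList.map fun y => (μ.real (s ⁻¹' {y}) / (c - δ)) • y
  have hl : ∀ u : E, (l.map fun v => |inner ℝ v u|).sum =
      (∫ x, |inner ℝ (s x) u| ∂μ) / (c - δ) := fun u => by
    rw [hsum, List.map_map, Finset.sum_map_toList, Finset.sum_div]
    refine Finset.sum_congr rfl fun y _ => ?_
    simp only [Function.comp_apply, inner_smul_left, RCLike.conj_to_real, abs_mul]
    rw [abs_of_nonneg (div_nonneg measureReal_nonneg hcδ.le)]
    ring
  refine ⟨l, closedBall_subset_zonotope fun u => ?_,
    zonotope_subset_closedBall (fun u => ?_) (by positivity)⟩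
  · rw [hl, le_div_iff₀ hcδ]
    have := (abs_le.mp (hclose u)).1
    linarith
  · rw [hl, div_le_iff₀ hcδ]
    have h1 := (abs_le.mp (hclose u)).2
    have h2 : c + δ = (1 + ε) * (c - δ) := by
      rw [hδ]
      field_simp
      ring
    calc _ ≤ (c + δ) * ‖u‖ := by linarith
      _ = _ := by rw [h2]; ring

end Ball

/-! ### Steiner's formula and quermassintegrals -/

/-- Steiner's formula, with nonnegative coefficients. -/
theorem exists_polynomial_measure_add_closedBall {E : Type} [NormedAddCommGroup E]
    [InnerProductSpace ℝ E] [FiniteDimensional ℝ E] [MeasurableSpace E] [BorelSpace E]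
    [Nontrivial E] {K : Set E} (hK : IsCompact K) (hc : Convex ℝ K) :
    ∃ a : Fin (Module.finrank ℝ E + 1) → ℝ, (∀ i, 0 ≤ a i) ∧ ∀ ρ : ℝ, 0 ≤ ρ →
      volume (K + ρ • Metric.closedBall (0 : E) 1) = ENNReal.ofReal (∑ i, a i * ρ ^ (i : ℕ)) := by
  set n := Module.finrank ℝ E
  set B : Set E := Metric.closedBall 0 1
  have hB : IsCompact B := isCompact_closedBall _ _
  let ε : ℕ → ℝ := fun N => 1 / ((N : ℝ) + 1)
  have hε : ∀ N, 0 < ε N := fun N => by positivity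
  choose l hl hl' using fun N => exists_zonotope_between_closedBall (E := E) (hε N)
  choose p hpd hpc hp using fun N =>
    exists_polynomial_measure_add_zonotope n E volume rfl (l N) K hK hc
  let b : ℕ → Fin (n + 1) → ℝ := fun N i => (p N).coeff i
  have heval : ∀ N ρ, (p N).eval ρ = ∑ i, b N i * ρ ^ (i : ℕ) := fun N ρ => by
    rw [Polynomial.eval_eq_sum_range' (Nat.lt_succ_of_le (hpd N)), ← Fin.sum_univ_eq_sum_range
      (fun i => (p N).coeff i * ρ ^ i)]
  have hthick : ∀ ρ r : ℝ, 0 ≤ ρ → 0 ≤ r →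
      K + ρ • Metric.closedBall (0 : E) r = Metric.cthickening (ρ * r) K := fun ρ r hρ hr => by
    rw [smul_closedBall ρ 0 hr, smul_zero, Real.norm_of_nonneg hρ,
      hK.add_closedBall_zero (by positivity)]
  have hlow : ∀ N ρ, 0 ≤ ρ → volume (K + ρ • B) ≤ ENNReal.ofReal (∑ i, b N i * ρ ^ (i : ℕ)) :=
    fun N ρ hρ => by
      rw [← heval, ← hp N ρ hρ]
      exact measure_mono (Set.add_subset_add_left (Set.smul_set_mono (hl N)))
  have hup : ∀ N ρ, 0 ≤ ρ → ENNReal.ofReal (∑ i, b N i * ρ ^ (i : ℕ)) ≤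
      volume (Metric.cthickening (ρ * (1 + ε N)) K) := fun N ρ hρ => by
    rw [← heval, ← hp N ρ hρ, ← hthick ρ _ hρ (by linarith [hε N])]
    exact measure_mono (Set.add_subset_add_left (Set.smul_set_mono (hl' N)))
  have hlim : ∀ ρ, 0 ≤ ρ → Filter.Tendsto (fun N => ENNReal.ofReal (∑ i, b N i * ρ ^ (i : ℕ)))
      Filter.atTop (nhds (volume (K + ρ • B))) := fun ρ hρ => by
    have hcK : IsCompact (K + ρ • B) := hK.add (hB.smul ρ)
    have h1 : Filter.Tendsto (fun N => ρ * ε N) Filter.atTop (nhds 0) := by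
      simpa [ε] using (tendsto_one_div_add_atTop_nhds_zero_nat (𝕜 := ℝ)).const_mul ρ
    have h2 := (tendsto_measure_cthickening_of_isCompact (μ := volume) hcK).comp h1
    refine tendsto_of_tendsto_of_tendsto_of_le_of_le tendsto_const_nhds h2
      (fun N => hlow N ρ hρ) fun N => (hup N ρ hρ).trans_eq ?_
    rw [Function.comp_apply, hthick ρ 1 hρ zero_le_one,
      cthickening_cthickening (mul_nonneg hρ (hε N).le) (by positivity)]
    ring_nf
  have hb0 : ∀ N i, 0 ≤ b N i := fun N i => hpc N i
  -- At `ρ = 1` the nonnegative coefficients sum to at most the volume of the parallel body at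
  -- distance `1 + ε N ≤ 2`, which bounds each of them uniformly in `N`.
  set M := (volume (Metric.cthickening 2 K)).toReal
  have hbM : ∀ N, b N ∈ Set.Icc (0 : Fin (n + 1) → ℝ) fun _ => M := fun N => by
    refine ⟨fun i => hb0 N i, fun i => ?_⟩
    have h1 : b N i ≤ ∑ i, b N i * (1 : ℝ) ^ (i : ℕ) := by
      simpa using Finset.single_le_sum (fun j _ => hb0 N j) (Finset.mem_univ i)
    refine h1.trans ?_
    rw [← ENNReal.ofReal_le_iff_le_toReal hK.cthickening.measure_lt_top.ne]
    refine (hup N 1 zero_le_one).trans (measure_mono (Metric.cthickening_mono ?_ K))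
    have : ε N ≤ 1 := by
      rw [div_le_one (by positivity)]
      linarith [(Nat.cast_nonneg N : (0 : ℝ) ≤ N)]
    linarith
  obtain ⟨a, ha, φ, hφ, hφa⟩ := isCompact_Icc.tendsto_subseq hbM
  refine ⟨a, fun i => ha.1 i, fun ρ hρ => ?_⟩
  refine tendsto_nhds_unique ((hlim ρ hρ).comp hφ.tendsto_atTop) ?_
  refine ENNReal.tendsto_ofReal (tendsto_finsetSum _ fun i _ => ?_)
  exact (tendsto_pi_nhds.mp hφa i).mul_const _

variable {n : ℕ}

theorem exists_isSteinerCoeff (hn : 1 ≤ n) {K : Set (EuclideanSpace ℝ (Fin n))}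
    (hK : IsCompact K) (hc : Convex ℝ K) :
    ∃ w : Fin (n + 1) → ℝ, (∀ i, 0 ≤ w i) ∧ IsSteinerCoeff K w := by
  have : Nonempty (Fin n) := ⟨⟨0, hn⟩⟩
  have := exists_polynomial_measure_add_closedBall hK hc
  rw [finrank_euclideanSpace_fin] at this
  obtain ⟨a, ha, h⟩ := this
  refine ⟨fun i => a i / n.choose i, fun i => div_nonneg (ha i) (by positivity), fun ρ hρ => ?_⟩
  rw [measureReal_def, h ρ hρ, ENNReal.toReal_ofReal
    (Finset.sum_nonneg fun i _ => mul_nonneg (ha i) (by positivity))]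
  refine Finset.sum_congr rfl fun i _ => ?_
  have : (n.choose i : ℝ) ≠ 0 :=
    Nat.cast_ne_zero.mpr (Nat.choose_pos (Nat.lt_succ_iff.mp i.2)).ne'
  field_simp

theorem quermass_nonneg (hn : 1 ≤ n) {K : Set (EuclideanSpace ℝ (Fin n))}
    (hK : IsCompact K) (hc : Convex ℝ K) (i : Fin (n + 1)) : 0 ≤ quermass i K := by
  obtain ⟨w, hw, h⟩ := exists_isSteinerCoeff hn hK hc
  rw [h.quermass_eq]
  exact hw i

theorem isSteinerCoeff_quermass (hn : 1 ≤ n) {K : Set (EuclideanSpace ℝ (Fin n))}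
    (hK : IsCompact K) (hc : Convex ℝ K) : IsSteinerCoeff K fun i => quermass i K := by
  obtain ⟨w, hw, h⟩ := exists_isSteinerCoeff hn hK hc
  simpa only [h.quermass_eq] using h

/-- The quermassintegrals are fixed linear combinations of the volumes of finitely many
parallel bodies. -/
theorem exists_quermass_eq_sum (i : Fin (n + 1)) :
    ∃ c : Fin (n + 1) → ℝ, ∀ K : Set (EuclideanSpace ℝ (Fin n)),
      (IsSteinerCoeff K fun i => quermass i K) →
      quermass i K = ∑ j : Fin (n + 1),
        c j * volume.real (K + (j : ℝ) • Metric.closedBall (0 : EuclideanSpace ℝ (Fin n)) 1) := by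
  -- Evaluating the expansion at the `n + 1` distinct radii `0, …, n` gives an invertible
  -- Vandermonde system.
  let V : Matrix (Fin (n + 1)) (Fin (n + 1)) ℝ := Matrix.vandermonde fun j => ((j : ℕ) : ℝ)
  have hV : IsUnit V.det := by
    rw [isUnit_iff_ne_zero, Matrix.det_vandermonde_ne_zero_iff]
    intro a b hab
    exact Fin.ext (Nat.cast_injective hab)
  refine ⟨fun j => (n.choose i : ℝ)⁻¹ * V⁻¹ i j, fun K hK => ?_⟩
  have hmul : V.mulVec (fun i => (n.choose i : ℝ) * quermass i K) = fun j : Fin (n + 1) =>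
      volume.real (K + ((j : ℕ) : ℝ) • Metric.closedBall (0 : EuclideanSpace ℝ (Fin n)) 1) := by
    funext j
    rw [hK j (Nat.cast_nonneg _)]
    simp only [V, Matrix.mulVec, dotProduct, Matrix.vandermonde_apply]
    exact Finset.sum_congr rfl fun i _ => mul_comm _ _
  have hinv := congrArg (fun x => V⁻¹.mulVec x i) hmul
  simp only [Matrix.mulVec_mulVec, Matrix.nonsing_inv_mul V hV, Matrix.one_mulVec] at hinv
  have : (n.choose i : ℝ) ≠ 0 :=
    Nat.cast_ne_zero.mpr (Nat.choose_pos (Nat.lt_succ_iff.mp i.2)).ne'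
  simp only [mul_assoc, ← Finset.mul_sum]
  rw [eq_inv_mul_iff_mul_eq₀ this]
  exact hinv

/-! ### Superlevel sets and the layer cake formula -/

variable {f : EuclideanSpace ℝ (Fin n) → ℝ≥0∞}

theorem QClass.isCompact_superlevel (hf : QClass f) {c : ℝ≥0∞} (hc : c ≠ 0) :
    IsCompact {x | c ≤ f x} := by
  have h := hf.vanishing.eventually_lt_const (pos_iff_ne_zero.mpr hc)
  obtain ⟨t, ht, hts⟩ := Filter.mem_cocompact.mp h
  refine ht.of_isClosed_subset (hf.upperSemicontinuous.isClosed_preimage c) fun x hx => ?_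
  by_contra hxt
  rw [Set.mem_ofPred_eq] at hx
  exact (hts hxt : f x < c).not_ge hx

theorem QClass.convex_superlevel (hf : QClass f) (c : ℝ≥0∞) : Convex ℝ {x | c ≤ f x} := by
  simpa using hf.quasiconcave c

/-- Upper semicontinuity makes the supremum over the compact ball a maximum; otherwise a point with
supremum exactly `c` could be missed. -/
theorem setOf_le_ballSup (hf : UpperSemicontinuous f) {ρ : ℝ} (hρ : 0 ≤ ρ) (c : ℝ≥0∞) :
    {x | c ≤ ballSup ρ f x} =
      {x | c ≤ f x} + ρ • Metric.closedBall (0 : EuclideanSpace ℝ (Fin n)) 1 := by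
  rw [smul_unitClosedBall_of_nonneg hρ]
  ext x
  simp only [Set.mem_ofPred_eq, Set.mem_add]
  constructor
  · intro h
    obtain ⟨y, hy, hmax⟩ := (hf.upperSemicontinuousOn (Metric.closedBall x ρ)).exists_isMaxOn
      ⟨x, Metric.mem_closedBall_self hρ⟩ (isCompact_closedBall x ρ)
    refine ⟨y, h.trans (iSup₂_le fun z hz => hmax hz), x - y, ?_, by abel⟩
    rwa [mem_closedBall_zero_iff, ← mem_closedBall_iff_norm']
  · rintro ⟨y, hy, z, hz, rfl⟩
    refine hy.trans (le_iSup₂_of_le y ?_ le_rfl)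
    rw [mem_closedBall_iff_norm']
    simpa using hz

theorem QClass.measurable_ballSup (hf : QClass f) {ρ : ℝ} (hρ : 0 ≤ ρ) :
    Measurable (ballSup ρ f) := by
  refine measurable_of_Ici fun c => ?_
  rcases eq_or_ne c 0 with rfl | hc
  · simp
  · change MeasurableSet {x | c ≤ ballSup ρ f x}
    rw [setOf_le_ballSup hf.upperSemicontinuous hρ]
    exact ((hf.isCompact_superlevel hc).add ((isCompact_closedBall _ _).smul ρ)).measurableSet

theorem volume_setOf_ofReal_le (c : ℝ≥0∞) :
    (volume : Measure ℝ) ({t : ℝ | ENNReal.ofReal t ≤ c} ∩ Set.Ioi 0) = c := by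
  rcases eq_or_ne c ∞ with rfl | hc
  · simp
  · have : {t : ℝ | ENNReal.ofReal t ≤ c} ∩ Set.Ioi 0 = Set.Ioc 0 c.toReal := by
      ext t
      simp [ENNReal.ofReal_le_iff_le_toReal hc, and_comm]
    rw [this, Real.volume_Ioc, sub_zero, ENNReal.ofReal_toReal hc]

/-- The layer cake formula for functions with values in `[0, ∞]`. -/
theorem lintegral_eq_lintegral_meas_ofReal_le {α : Type*} [MeasurableSpace α] (μ : Measure α)
    [SFinite μ] {g : α → ℝ≥0∞} (hg : Measurable g) :
    ∫⁻ x, g x ∂μ = ∫⁻ t in Set.Ioi (0 : ℝ), μ {x | ENNReal.ofReal t ≤ g x} := by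
  have hm : MeasurableSet {q : α × ℝ | ENNReal.ofReal q.2 ≤ g q.1} :=
    measurableSet_le (by fun_prop) (by fun_prop)
  let F : α → ℝ → ℝ≥0∞ := fun x t =>
    {q : α × ℝ | ENNReal.ofReal q.2 ≤ g q.1}.indicator 1 (x, t)
  have hF : Measurable (Function.uncurry F) := measurable_one.indicator hm
  have h1 : ∀ x, g x = ∫⁻ t in Set.Ioi (0 : ℝ), F x t := fun x => by
    have hmx : MeasurableSet {t : ℝ | ENNReal.ofReal t ≤ g x} :=
      measurableSet_le (by fun_prop) measurable_const
    have : ∀ t, F x t = {t : ℝ | ENNReal.ofReal t ≤ g x}.indicator 1 t := fun t => rfl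
    simp_rw [this]
    rw [lintegral_indicator_one hmx, Measure.restrict_apply hmx, volume_setOf_ofReal_le]
  have h2 : ∀ t, ∫⁻ x, F x t ∂μ = μ {x | ENNReal.ofReal t ≤ g x} := fun t => by
    have hmt : MeasurableSet {x | ENNReal.ofReal t ≤ g x} :=
      measurableSet_le measurable_const hg
    rw [← lintegral_indicator_one hmt]
    rfl
  simp_rw [h1]
  rw [lintegral_lintegral_swap hF.aemeasurable]
  simp_rw [h2, ← h1]

/-- By `exists_quermass_eq_sum` it is enough to treat volumes of parallel bodies of the superlevel
sets, and these are antitone in `t`. -/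
theorem QClass.aemeasurable_quermass_superlevel (hn : 1 ≤ n) (hf : QClass f) (i : Fin (n + 1)) :
    AEMeasurable (fun t : ℝ => quermass i {x | ENNReal.ofReal t ≤ f x})
      (volume.restrict (Set.Ioi 0)) := by
  obtain ⟨c, hc⟩ := exists_quermass_eq_sum i
  refine AEMeasurable.congr (f := fun t : ℝ => ∑ j : Fin (n + 1), c j *
    volume.real ({x | ENNReal.ofReal t ≤ f x} +
      (j : ℝ) • Metric.closedBall (0 : EuclideanSpace ℝ (Fin n)) 1)) ?_ ?_
  · refine (Finset.measurable_sum _ fun j _ => Measurable.const_mul ?_ _).aemeasurable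
    refine Measurable.ennreal_toReal (Antitone.measurable fun s t hst => measure_mono ?_)
    exact Set.add_subset_add_right fun x hx => (ENNReal.ofReal_le_ofReal hst).trans hx
  · filter_upwards [ae_restrict_mem measurableSet_Ioi] with t ht
    exact (hc _ (isSteinerCoeff_quermass hn (hf.isCompact_superlevel
      (ENNReal.ofReal_pos.mpr ht).ne') (hf.convex_superlevel _))).symm

end FunctionalSteiner

/-! ### The functional Steiner formula -/

theorem theorem3p4 (n : ℕ) (hn : 1 ≤ n) (f : EuclideanSpace ℝ (Fin n) → ℝ≥0∞)
    (hf : FunctionalSteiner.QClass f) (ρ : ℝ) (hρ : 0 < ρ) :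
    ∫⁻ x, FunctionalSteiner.ballSup ρ f x =
      ∑ i : Fin (n + 1),
        (n.choose i : ℝ≥0∞) * FunctionalSteiner.functionalQuermass i f *
          ENNReal.ofReal ρ ^ (i : ℕ) := by
  have hmeas := fun i => (hf.aemeasurable_quermass_superlevel hn i).ennreal_ofReal
  rw [FunctionalSteiner.lintegral_eq_lintegral_meas_ofReal_le _ (hf.measurable_ballSup hρ.le)]
  have hrhs : ∀ i : Fin (n + 1), (n.choose i : ℝ≥0∞) *
      FunctionalSteiner.functionalQuermass i f * ENNReal.ofReal ρ ^ (i : ℕ) =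
      ∫⁻ t in Set.Ioi (0 : ℝ), (n.choose i : ℝ≥0∞) *
        ENNReal.ofReal (FunctionalSteiner.quermass i {x | ENNReal.ofReal t ≤ f x}) *
          ENNReal.ofReal ρ ^ (i : ℕ) := fun i => by
    rw [lintegral_mul_const'' _ ((hmeas i).const_mul _), lintegral_const_mul'' _ (hmeas i),
      FunctionalSteiner.functionalQuermass]
  simp_rw [hrhs]
  rw [← lintegral_finsetSum' _ fun i _ => ((hmeas i).const_mul _).mul_const _]
  -- What remains is Steiner's formula for a single superlevel set; nonnegativity of the
  -- quermassintegrals lets `ENNReal.ofReal` pass through the sum.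
  refine setLIntegral_congr_fun measurableSet_Ioi fun t ht => ?_
  have hK := hf.isCompact_superlevel (ENNReal.ofReal_pos.mpr ht).ne'
  have hc := hf.convex_superlevel (ENNReal.ofReal t)
  have hcK : IsCompact ({x | ENNReal.ofReal t ≤ f x} +
      ρ • Metric.closedBall (0 : EuclideanSpace ℝ (Fin n)) 1) :=
    hK.add ((isCompact_closedBall _ _).smul ρ)
  have hq := FunctionalSteiner.quermass_nonneg hn hK hc
  rw [FunctionalSteiner.setOf_le_ballSup hf.upperSemicontinuous hρ.le,
    ← ENNReal.ofReal_toReal hcK.measure_lt_top.ne, ← measureReal_def,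
    FunctionalSteiner.isSteinerCoeff_quermass hn hK hc ρ hρ.le,
    ENNReal.ofReal_sum_of_nonneg fun i _ => by have := hq i; positivity]
  refine Finset.sum_congr rfl fun i _ => ?_
  rw [ENNReal.ofReal_mul (mul_nonneg (by positivity) (hq i)), ENNReal.ofReal_mul (by positivity),
    ENNReal.ofReal_pow hρ.le, ENNReal.ofReal_natCast]
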